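/- Let $K$ be a field and let $\mathcal{O}=\{t_1,\dots,t_\mu\}$ be an order ideal of terms in two indeterminates $x_1,x_2$, i.e. a finite set of terms $x_1^a x_2^b$ such that every term dividing an element of $\mathcal{O}$ is in $\mathcal{O}$. Let $\partial\mathcal{O}=(x_1\mathcal{O}\cup x_2\mathcal{O})\setminus\mathcal{O}=\{b_1,\dots,b_\nu\}$ be its border, and let $K[C]=K[c_{ij}\mid 1\le i\le\mu,\ 1\le j\le\nu]$. For $r=1,2$ let $\mathcal{A}_r=(a^{(r)}_{ij})\in\mathrm{Mat}_\mu(K[C])$ be the generic multiplication matrix, with $a^{(r)}_{ij}=\delta_{im}$ if $x_rt_j=t_m$ and $a^{(r)}_{ij}=c_{im}$ if $x_rt_j=b_m$. Let $I(\mathbb{B}_{\mathcal{O}})\subseteq K[C]$ be the ideal generated by the entries of $\mathcal{A}_1\mathcal{A}_2-\mathcal{A}_2\mathcal{A}_1$, and let $B_{\mathcal{O}}=K[C]/I(\mathbb{B}_{\mathcal{O}})$ be the coordinate ring of the planar border basis scheme $\mathbb{B}_{\mathcal{O}}$. Two distinct border terms $b,b'$ are called across-the-rim neighbors if $b=x_kt$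 and $b'=x_{\ell}t$ for some $t\in\mathcal{O}$ and some $k,\ell$. The indeterminate $c_{ij}$ is called exposed if there is an $\ell\in\{1,2\}$ such that $x_\ell t_i\in\partial\mathcal{O}$ and such that there is a border term $b_{j'}$ with either $b_{j'}=x_\ell b_j$, or with $b_j,b_{j'}$ across-the-rim neighbors and $x_kb_{j'}=x_\ell b_j$ for some $k$. The indeterminate $c_{ij}$ is called basic if it does not occur in the linear part (the homogeneous component of degree one) of any of the above generators of $I(\mathbb{B}_{\mathcal{O}})$. For a tuple $Z=(z_1,\dots,z_s)$ of distinct indeterminates in $C$ and an ideal $I\subseteq K[C]$, we say that $I$ has a $Z$-separating re-embedding if there are $h_1,\dots,h_s\in K[C\setminus Z]$ with $z_i-h_i\in I$ for all $i$, together with a $K$-algebra isomorphism $K[C]/I\to K[C\setminus Z]/(I\cap K[C\setminus Z])$ that sends the class of $z_i$ to the class of $h_i$ for every $i$ and the class of $c$ to the class of $c$ for every $c\in C\setminus Z$. Then the following claims hold. (a) The residue classes modulo $I(\mathbb{B}_{\mathcal{O}})$ of the exposed indeterminates generate the $K$-algebra $B_{\mathcal{O}}$. (b) Every basic indeterminate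 is exposed and is not contained in any tuple $Z$ of distinct indeterminates in $C$ for which $I(\mathbb{B}_{\mathcal{O}})$ has a $Z$-separating re-embedding. -/

import Mathlib

/-! Terms `x_1^{a_1} ⋯ x_n^{a_n}` are represented by their exponents `Fin n →₀ ℕ`; divisibility of
terms is `≤`, and multiplication by `x_k` is addition of `Finsupp.single k 1`. -/

namespace BorderBasis

variable {n : ℕ}

/-- The term `x_k * t`. -/
noncomputable def mulVar (k : Fin n) (t : Fin n →₀ ℕ) : Fin n →₀ ℕ := t + Finsupp.single k 1

/-- An order ideal: a finite set of terms that contains every divisor of each of its terms. -/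
def IsOrderIdeal (O : Finset (Fin n →₀ ℕ)) : Prop :=
  ∀ t ∈ O, ∀ t' : Fin n →₀ ℕ, t' ≤ t → t' ∈ O

/-- The border `∂O = (x_1 O ∪ ⋯ ∪ x_n O) \ O`. -/
noncomputable def border (O : Finset (Fin n →₀ ℕ)) : Finset (Fin n →₀ ℕ) :=
  (Finset.univ.biUnion fun k : Fin n => O.image (mulVar k)) \ O

theorem mulVar_mem_border {O : Finset (Fin n →₀ ℕ)} {k : Fin n} {t : Fin n →₀ ℕ}
    (ht : t ∈ O) (h : mulVar k t ∉ O) : mulVar k t ∈ border O :=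
  Finset.mem_sdiff.2
    ⟨Finset.mem_biUnion.2 ⟨k, Finset.mem_univ k, Finset.mem_image_of_mem _ ht⟩, h⟩

/-- The index set of the indeterminates: the pair `(t_i, b_j)` stands for `c_{ij}`. -/
abbrev Indet (O : Finset (Fin n →₀ ℕ)) : Type := {t // t ∈ O} × {b // b ∈ border O}

section Scheme

variable (K : Type*) [Field K] (O : Finset (Fin n →₀ ℕ))


/-- The generic multiplication matrix `A_r` with entries in `K[C]`. Its column indexed by `t_j` is
a unit column if `x_r t_j = t_m ∈ O`, and is `(c_{1m}, …, c_{μm})` if `x_r t_j = b_m ∈ ∂O`. -/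
noncomputable def multMatrix (r : Fin n) :
    Matrix {t // t ∈ O} {t // t ∈ O} (MvPolynomial (Indet O) K) :=
  Matrix.of fun i j =>
    if h : mulVar r j.1 ∈ O then
      if i = ⟨mulVar r j.1, h⟩ then 1 else 0
    else MvPolynomial.X (i, ⟨mulVar r j.1, mulVar_mem_border j.2 h⟩)

/-- The defining generators of the ideal of the border basis scheme: the entries of the
commutators `A_r A_s - A_s A_r` for `r < s`. -/
noncomputable def generators : Set (MvPolynomial (Indet O) K) :=
  {f | ∃ r s : Fin n, r < s ∧ ∃ i j : {t // t ∈ O},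
    f = (multMatrix K O r * multMatrix K O s - multMatrix K O s * multMatrix K O r) i j}

/-- The ideal `I(𝔹_O)` in `K[C]`. -/
noncomputable def schemeIdeal : Ideal (MvPolynomial (Indet O) K) := Ideal.span (generators K O)

/-- The coordinate ring `B_O = K[C] / I(𝔹_O)`. -/
abbrev CoordRing : Type _ := MvPolynomial (Indet O) K ⧸ schemeIdeal K O

/-- `c` is basic if it does not occur in the linear part of a generator of `I(𝔹_O)`. -/
def IsBasic (c : Indet O) : Prop :=
  ∀ g ∈ generators K O, c ∉ (MvPolynomial.homogeneousComponent 1 g).vars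

end Scheme

section Exposed

variable (O : Finset (Fin n →₀ ℕ))

/-- Two distinct terms of the form `x_k t` and `x_l t` with `t ∈ O`. -/
def AcrossTheRim (b b' : Fin n →₀ ℕ) : Prop :=
  b ≠ b' ∧ ∃ k l : Fin n, ∃ t ∈ O, b = mulVar k t ∧ b' = mulVar l t

/-- The indeterminate `c_{ij}`, with `c = (t_i, b_j)`, is `x_l`-exposed: `x_l t_i ∈ ∂O`, and there
is a border term `b'` such that `b_j, b'` are next-door neighbors with `b' = x_l b_j`, or
across-the-rim neighbors with `x_k b' = x_l b_j` for some `k`. -/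
def IsExposedAt (l : Fin n) (c : Indet O) : Prop :=
  mulVar l c.1.1 ∈ border O ∧
    ∃ b' ∈ border O, b' = mulVar l c.2.1 ∨
      (AcrossTheRim O c.2.1 b' ∧ ∃ k : Fin n, mulVar k b' = mulVar l c.2.1)

/-- `c` is exposed if it is `x_l`-exposed for some `l`. -/
def IsExposed (c : Indet O) : Prop := ∃ l : Fin n, IsExposedAt O l c

end Exposed

section Reembedding

variable {K : Type*} [Field K] {σ : Type*}

/-- The inclusion `K[C ∖ Z] → K[C]`. -/
noncomputable def inclCompl {s : ℕ} (Z : Fin s → σ) :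
    MvPolynomial {c : σ // c ∉ Set.range Z} K →ₐ[K] MvPolynomial σ K :=
  MvPolynomial.rename Subtype.val

/-- The elimination ideal `I ∩ K[C ∖ Z]`. -/
noncomputable def elimIdeal {s : ℕ} (I : Ideal (MvPolynomial σ K)) (Z : Fin s → σ) :
    Ideal (MvPolynomial {c : σ // c ∉ Set.range Z} K) :=
  I.comap (inclCompl Z)

/-- `I` has a `Z`-separating re-embedding, for a tuple `Z = (z_1, …, z_s)` of distinct
indeterminates: `I` contains a coherently `Z`-separating tuple `(z_1 - h_1, …, z_s - h_s)`, that is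
with `h_1, …, h_s ∈ K[C ∖ Z]`, and there is an isomorphism of `K`-algebras
`Φ : K[C] / I → K[C ∖ Z] / (I ∩ K[C ∖ Z])` with `z_i ↦ h_i` and `c ↦ c` for `c ∉ Z`. -/
def HasSeparatingReembedding {s : ℕ} (I : Ideal (MvPolynomial σ K)) (Z : Fin s → σ) : Prop :=
  Function.Injective Z ∧
  ∃ h : Fin s → MvPolynomial {c : σ // c ∉ Set.range Z} K,
    (∀ i, MvPolynomial.X (Z i) - inclCompl Z (h i) ∈ I) ∧
    ∃ Φ : (MvPolynomial σ K ⧸ I) ≃ₐ[K]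
        (MvPolynomial {c : σ // c ∉ Set.range Z} K ⧸ elimIdeal I Z),
      (∀ i, Φ (Ideal.Quotient.mk I (MvPolynomial.X (Z i))) =
        Ideal.Quotient.mk (elimIdeal I Z) (h i)) ∧
      ∀ c : {c : σ // c ∉ Set.range Z},
        Φ (Ideal.Quotient.mk I (MvPolynomial.X c.1)) =
          Ideal.Quotient.mk (elimIdeal I Z) (MvPolynomial.X c)

end Reembedding

end BorderBasis

/-!
The coordinates of the border terms are recovered from the exposed indeterminates by solving the
neighbour syzygies of the border basis over the subalgebra that the exposed indeterminates generate.

Write `x`, `y` for `x_1`, `x_2`. Let `B` be the coordinate ring, `X` and `Y` the commuting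
multiplication matrices over `B`, and `E = (t)_{t ∈ O}` the row of the terms of `O` in `B[x][y]`.
The border basis polynomials `g_b = b - ∑ c_{tb} t` are, up to zeros, the entries of `E (x - X)` and
of `E (y - Y)`. A family `Φ` of polynomials indexed by the border gives two rows `a`, `a'`, with the
entries `Φ (x t)` and `Φ (y t)` at those `t` for which `x t`, respectively `y t`, is a border term.
The syzygies are the equation `a (y - Y) = a' (x - X)` (`IsSyzygy`), and `Φ = g` is a solution.

* The characteristic polynomials of `X` in `x` and of `Y` in `y` form a regular sequence, so the
  Koszul complex of `x - X` and `y - Y` is exact, and a solution has the form `a = c (x - X)`,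
  `a' = c (y - Y)`. The vanishing entries of `a` and `a'` force `c` to be a multiple of `E`. Hence
  every solution is a multiple of `g` (`IsSyzygy.exists_eq_prebasisPoly_mul`), and it is equal to `g`
  if it is monic in `y` of degree at most `h` at the first border term `y^h`
  (`IsSyzygy.eq_prebasisPoly`).
* As `a` and `a'` are supported in the ends of the rows and of the columns of `O`, the only
  indeterminates in the equation are exposed (`isExposed_mulVar`). So it makes sense over the
  subalgebra `S` generated by the exposed elements, and there it has a solution that is monic at
  `y^h` (`exists_isSyzygy`): all values of `Φ` are `S[x]`-linear combinations of `Φ (y^h)` and of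
  the values `φ_t = Φ (x t)` at the ends `t` of the at most `h` rows. What remains is an equation
  `y φ = φ N + Φ (y^h) v` with a square matrix `N` and a row `v` over `S[x]`, solved by Cramer's
  rule with the characteristic polynomial of `N` as `Φ (y^h)`.

Together these show that the coefficients `-c_{tb}` of `g_b` lie in `S`.

For a basic indeterminate `c_{ub}` with `b = x_q t`, and the other index `l`, the generator at the
position `(x_l u, t)` would contain `c_{ub}` in its linear part if `x_l u` were in `O`. So `x_l u`
is a border term and `c_{ub}` is exposed. The generators have no constant term, so no element of the
ideal has a basic indeterminate in its linear part, whereas the linear part of `z - h` contains `z`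
if `z` does not occur in `h` (`IsBasic.notMem_range`).
-/

namespace BorderBasis

open Polynomial Matrix

/-! ### Terms in two indeterminates -/

section Terms

/-- The term `x_1^a x_2^b`. -/
noncomputable def planeTerm (a b : ℕ) : Fin 2 →₀ ℕ := Finsupp.single 0 a + Finsupp.single 1 b

@[simp] lemma planeTerm_zero (a b : ℕ) : planeTerm a b 0 = a := by simp [planeTerm]

@[simp] lemma planeTerm_one (a b : ℕ) : planeTerm a b 1 = b := by simp [planeTerm]

lemma planeTerm_eta (t : Fin 2 →₀ ℕ) : planeTerm (t 0) (t 1) = t := by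
  ext i; fin_cases i <;> simp

@[simp] lemma mulVar_zero_zero (t : Fin 2 →₀ ℕ) : mulVar 0 t 0 = t 0 + 1 := by simp [mulVar]

@[simp] lemma mulVar_zero_one (t : Fin 2 →₀ ℕ) : mulVar 0 t 1 = t 1 := by simp [mulVar]

@[simp] lemma mulVar_one_zero (t : Fin 2 →₀ ℕ) : mulVar 1 t 0 = t 0 := by simp [mulVar]

@[simp] lemma mulVar_one_one (t : Fin 2 →₀ ℕ) : mulVar 1 t 1 = t 1 + 1 := by simp [mulVar]

variable {n : ℕ}

lemma mulVar_comm (k l : Fin n) (t : Fin n →₀ ℕ) :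
    mulVar k (mulVar l t) = mulVar l (mulVar k t) := by
  simp only [mulVar, add_right_comm]

lemma le_mulVar (k : Fin n) (t : Fin n →₀ ℕ) : t ≤ mulVar k t := le_self_add

lemma mem_border_iff {O : Finset (Fin n →₀ ℕ)} {b : Fin n →₀ ℕ} :
    b ∈ border O ↔ (∃ k, ∃ t ∈ O, mulVar k t = b) ∧ b ∉ O := by
  simp [border]

lemma IsOrderIdeal.of_mulVar {O : Finset (Fin n →₀ ℕ)} (hO : IsOrderIdeal O) {k : Fin n}
    {t : Fin n →₀ ℕ} (h : mulVar k t ∈ O) : t ∈ O :=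
  hO _ h _ (le_mulVar k t)

end Terms

/-! ### Exactness of the Koszul complex of two commuting matrices -/

section Koszul

variable {ι R : Type*} [Fintype ι] [DecidableEq ι] [CommRing R]

/-- Exactness of the Koszul complex of two commuting matrices `U`, `V` whose determinants form a
regular sequence. -/
lemma exists_eq_vecMul_of_vecMul_eq {U V : Matrix ι ι R} (hUV : U * V = V * U)
    (hU : IsLeftRegular U.det) (hdvd : ∀ p, U.det ∣ V.det * p → U.det ∣ p) {a b : ι → R}
    (h : a ᵥ* V = b ᵥ* U) : ∃ c : ι → R, a = c ᵥ* U ∧ b = c ᵥ* V := by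
  have cancel : ∀ {v w : ι → R}, U.det • v = U.det • w → v = w := fun {v w} e =>
    funext fun i => hU (congrFun e i)
  have cancelU : ∀ {v w : ι → R}, v ᵥ* U = w ᵥ* U → v = w := fun {v w} e => cancel <| by
    have := congrArg (fun z => z ᵥ* U.adjugate) e
    simpa [vecMul_vecMul, mul_adjugate, vecMul_smul] using this
  have hadj : V * U.adjugate = U.adjugate * V := by
    have e : U.det • (V * U.adjugate) = U.det • (U.adjugate * V) := by
      calc U.det • (V * U.adjugate) = U.adjugate * U * (V * U.adjugate) := by
            rw [adjugate_mul, smul_mul, Matrix.one_mul]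
        _ = U.adjugate * V * (U * U.adjugate) := by
            simp only [Matrix.mul_assoc]; rw [← Matrix.mul_assoc U V, hUV, Matrix.mul_assoc]
        _ = U.det • (U.adjugate * V) := by
            rw [mul_adjugate, Matrix.mul_smul, Matrix.mul_one]
    ext i j
    exact hU (congrFun (congrFun e i) j)
  have h1 : (a ᵥ* U.adjugate) ᵥ* V = U.det • b := by
    rw [vecMul_vecMul, ← hadj, ← vecMul_vecMul, h, vecMul_vecMul, mul_adjugate, vecMul_smul,
      vecMul_one]
  have h2 : V.det • (a ᵥ* U.adjugate) = U.det • (b ᵥ* V.adjugate) := by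
    have e : U.det • (b ᵥ* V.adjugate) = (U.det • b) ᵥ* V.adjugate := (smul_vecMul _ _ _).symm
    rw [e, ← h1, vecMul_vecMul, mul_adjugate, vecMul_smul, vecMul_one]
  have h3 : ∀ i, U.det ∣ (a ᵥ* U.adjugate) i := fun i =>
    hdvd _ ⟨_, congrFun h2 i⟩
  choose c hc using h3
  have hc' : a ᵥ* U.adjugate = U.det • c := funext hc
  have ha : a = c ᵥ* U := cancel <| by
    rw [← smul_vecMul, ← hc', vecMul_vecMul, adjugate_mul, vecMul_smul, vecMul_one]
  refine ⟨c, ha, cancelU ?_⟩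
  rw [← h, ha, vecMul_vecMul, vecMul_vecMul, hUV]

end Koszul

/-! ### The neighbour syzygies and a monic solution -/

section Syzygy

variable {A : Type*} [CommRing A]

/-- The matrix of the multiplication by `x_r` with respect to `O`, when the term `b` in the border
has the coordinates `s · b`. -/
noncomputable def mulMatrix {n : ℕ} (O : Finset (Fin n →₀ ℕ))
    (s : {t // t ∈ O} → (Fin n →₀ ℕ) → A) (r : Fin n) : Matrix {t // t ∈ O} {t // t ∈ O} A :=
  Matrix.of fun i j =>
    if mulVar r j.1 ∈ O then (if i.1 = mulVar r j.1 then 1 else 0) else s i (mulVar r j.1)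

/-- The entry at `t ∈ O` is `Φ (x_r t)` if `x_r t` is a border term, and `0` otherwise. -/
noncomputable def borderRow {n : ℕ} {M : Type*} [Zero M] (O : Finset (Fin n →₀ ℕ))
    (Φ : (Fin n →₀ ℕ) → M) (r : Fin n) (t : {t // t ∈ O}) : M :=
  if mulVar r t.1 ∈ O then 0 else Φ (mulVar r t.1)

/-- The family `Φ`, of which only the values at the border terms matter, satisfies the neighbour
syzygies `a (x_2 - M_2) = a' (x_1 - M_1)` of a border basis in the polynomial ring `A[x_1][x_2]`. Here
`a` and `a'` are the rows `borderRow O Φ 0` and `borderRow O Φ 1`, and `M_r` is the matrix of the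
multiplication by `x_r`. These matrices are not assumed to commute. -/
def IsSyzygy (O : Finset (Fin 2 →₀ ℕ)) (s : {t // t ∈ O} → (Fin 2 →₀ ℕ) → A)
    (Φ : (Fin 2 →₀ ℕ) → A[X][X]) : Prop :=
  ∀ j, X * borderRow O Φ 0 j - ∑ i, C (C (mulMatrix O s 1 i j)) * borderRow O Φ 0 i =
    C X * borderRow O Φ 1 j - ∑ i, C (C (mulMatrix O s 0 i j)) * borderRow O Φ 1 i

/-- The last terms of the rows of `O`. -/
abbrev RowEnd (O : Finset (Fin 2 →₀ ℕ)) : Type := {t : {t // t ∈ O} // ¬ mulVar 0 t.1 ∈ O}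

open Classical in
/-- The coordinates of `Φ (x_1^a x_2^b)`, where `Φ` is a solution of the syzygies, with respect to
the value of `Φ` at the border term `x_2^h` and its values at `x_1 t` for the row ends `t`. The
recursion for a border term `x_1 u` with `u ∉ O` is the syzygy at `u / x_2`. -/
noncomputable def syzygyCoord (O : Finset (Fin 2 →₀ ℕ)) (s : {t // t ∈ O} → (Fin 2 →₀ ℕ) → A)
    (b : ℕ) : ℕ → A[X] × (RowEnd O → A[X])
  | 0 => (1, 0)
  | a + 1 =>
    if planeTerm a b ∈ O then (0, fun p => if p.1.1 = planeTerm a b then 1 else 0)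
    else (X : A[X]) • syzygyCoord O s b a + (0, fun p => C (s p.1 (planeTerm a b)))

lemma card_rowEnd_le {O : Finset (Fin 2 →₀ ℕ)} (hO : IsOrderIdeal O) {h : ℕ}
    (hh : planeTerm 0 h ∉ O) : Nat.card (RowEnd O) ≤ h := by
  have hlt : ∀ t ∈ O, t 1 < h := fun t ht => by
    by_contra! hle
    refine hh (hO t ht _ fun i => ?_)
    fin_cases i <;> simp [hle]
  have aux : ∀ p q : RowEnd O, p.1.1 1 = q.1.1 1 → p.1.1 0 ≤ q.1.1 0 := fun p q e => by
    by_contra! hl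
    refine q.2 (hO _ p.1.2 _ fun i => ?_)
    fin_cases i
    · simpa using hl
    · simp [e]
  have hinj : Function.Injective fun p : RowEnd O => (⟨p.1.1 1, hlt _ p.1.2⟩ : Fin h) := by
    intro p q e
    have e1 : p.1.1 1 = q.1.1 1 := congrArg Fin.val e
    have e0 := le_antisymm (aux p q e1) (aux q p e1.symm)
    apply Subtype.ext; apply Subtype.ext
    rw [← planeTerm_eta p.1.1, ← planeTerm_eta q.1.1, e0, e1]
  simpa using Nat.card_le_card_of_injective _ hinj

/-- Cramer's rule for the inhomogeneous eigenvector equation `y φ = φ N + G a`, solved with `G` the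
characteristic polynomial of `N` in the indeterminate `y`. -/
lemma exists_monic_inhomogeneous_eigenvector {ι R : Type*} [Fintype ι] [DecidableEq ι] [CommRing R]
    [Nontrivial R] (N : Matrix ι ι R) (a : ι → R) :
    ∃ (φ : ι → R[X]) (G : R[X]), G.Monic ∧ G.natDegree = Fintype.card ι ∧
      ∀ t, X * φ t = C (a t) * G + ∑ p, C (N p t) * φ p := by
  refine ⟨(fun t => C (a t)) ᵥ* N.charmatrix.adjugate, N.charpoly, N.charpoly_monic,
    N.charpoly_natDegree_eq_dim, fun t => ?_⟩
  set φ : ι → R[X] := (fun t => C (a t)) ᵥ* N.charmatrix.adjugate with hφ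
  have h1 : φ ᵥ* N.charmatrix = N.charpoly • fun t => C (a t) := by
    simp only [hφ, vecMul_vecMul, adjugate_mul, vecMul_smul, vecMul_one]
    rfl
  have h2 := congrFun h1 t
  have h3 : (φ ᵥ* (scalar ι) (X : R[X])) t = φ t * X := by
    simp [vecMul, dotProduct, Matrix.diagonal_apply]
  rw [charmatrix, vecMul_sub, Pi.sub_apply, h3] at h2
  simp only [vecMul, dotProduct, Pi.smul_apply, smul_eq_mul] at h2
  rw [mul_comm X, eq_add_of_sub_eq h2, mul_comm N.charpoly]
  congr 1
  refine Finset.sum_congr rfl fun p _ => ?_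
  rw [mul_comm]; rfl

/-- The first border row of a family is supported in the row ends. -/
lemma sum_mul_borderRow_zero {M : Type*} [CommRing M] {O : Finset (Fin 2 →₀ ℕ)}
    [Fintype (RowEnd O)] (Φ : (Fin 2 →₀ ℕ) → M) (F : {t // t ∈ O} → M) :
    ∑ i, F i * borderRow O Φ 0 i = ∑ p : RowEnd O, F p.1 * Φ (mulVar 0 p.1.1) := by
  classical
  have hF : ∀ i ∈ Finset.univ, F i * borderRow O Φ 0 i ≠ 0 → ¬ mulVar 0 i.1 ∈ O :=
    fun i _ hi h => hi (by rw [borderRow, if_pos h, mul_zero])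
  rw [← Finset.sum_filter_of_ne hF, Finset.sum_subtype _ (p := fun i : {t // t ∈ O} =>
    ¬ mulVar 0 i.1 ∈ O) (fun i => by simp)]
  refine Finset.sum_congr rfl fun p _ => ?_
  rw [borderRow, if_neg p.2]

open Classical in
/-- For all values of `s` the syzygies have a solution that is monic at the border term `x_2^h`, with
the number of the rows of `O` as its degree in `x_2`. -/
theorem exists_isSyzygy [Nontrivial A] {O : Finset (Fin 2 →₀ ℕ)} (hO : IsOrderIdeal O)
    (s : {t // t ∈ O} → (Fin 2 →₀ ℕ) → A) :
    ∃ Φ : (Fin 2 →₀ ℕ) → A[X][X], IsSyzygy O s Φ ∧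
      ∀ h, (Φ (planeTerm 0 h)).Monic ∧ (Φ (planeTerm 0 h)).natDegree = Nat.card (RowEnd O) := by
  let w : (Fin 2 →₀ ℕ) → A[X] × (RowEnd O → A[X]) := fun b => syzygyCoord O s (b 1) (b 0)
  have w_mem : ∀ u ∈ O, w (mulVar 0 u) = (0, fun p => if p.1.1 = u then 1 else 0) := by
    intro u hu
    simp only [w, mulVar_zero_zero, mulVar_zero_one, syzygyCoord, planeTerm_eta, if_pos hu]
  have w_notMem : ∀ u ∉ O, w (mulVar 0 u) = (X : A[X]) • w u + (0, fun p => C (s p.1 u)) := by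
    intro u hu
    simp only [w, mulVar_zero_zero, mulVar_zero_one, syzygyCoord, planeTerm_eta, if_neg hu]
  let Q : RowEnd O → A[X] × (RowEnd O → A[X]) := fun t =>
    (0, fun p => C (mulMatrix O s 1 p.1 t.1)) + (X : A[X]) • borderRow O w 1 t.1
      - ∑ i, C (s i (mulVar 0 t.1.1)) • borderRow O w 1 i
  obtain ⟨φ, G, hG, hGdeg, hφ'⟩ :=
    exists_monic_inhomogeneous_eigenvector (Matrix.of fun p t => (Q t).2 p) fun t => (Q t).1
  let ev : A[X] × (RowEnd O → A[X]) →ₗ[A[X]] A[X][X] :=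
    (LinearMap.toSpanSingleton A[X] _ G).coprod (Fintype.linearCombination A[X] φ)
  have ev_apply : ∀ k l, ev (k, l) = C k * G + ∑ p, C (l p) * φ p := fun k l => by
    simp [ev, Fintype.linearCombination_apply, smul_eq_C_mul]
  have ev_zero : ∀ l, ev (0, l) = ∑ p, C (l p) * φ p := fun l => by simp [ev_apply]
  have hφ : ∀ t, X * φ t = ev (Q t) := fun t => by
    rw [← Prod.mk.eta (p := Q t), ev_apply, hφ']
    rfl
  let Φ : (Fin 2 →₀ ℕ) → A[X][X] := fun b => ev (w b)
  have Φ_mem : ∀ t : RowEnd O, Φ (mulVar 0 t.1.1) = φ t := by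
    intro t
    simp only [Φ, w_mem _ t.1.2, ev_apply]
    rw [Finset.sum_eq_single t]
    · simp
    · intro p _ hp
      rw [if_neg fun e => hp (Subtype.ext (Subtype.ext e))]; simp
    · simp
  have Φ_row : ∀ i, borderRow O Φ 1 i = ev (borderRow O w 1 i) := fun i => by
    unfold borderRow; split_ifs <;> simp [Φ]
  have sum_row : ∀ F : {t // t ∈ O} → A[X][X],
      ∑ i, F i * borderRow O Φ 0 i = ∑ p : RowEnd O, F p.1 * φ p := by
    intro F
    rw [sum_mul_borderRow_zero]
    simp only [Φ_mem]
  refine ⟨Φ, fun t => ?_, fun h => ?_⟩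
  · rw [sum_row]
    by_cases hx : mulVar 0 t.1 ∈ O
    · have h0 : borderRow O Φ 0 t = 0 := if_pos hx
      have hX : ∀ i, mulMatrix O s 0 i t = if i = ⟨mulVar 0 t.1, hx⟩ then 1 else 0 := fun i => by
        simp [mulMatrix, hx, Subtype.ext_iff]
      simp only [h0, hX]
      rw [Finset.sum_eq_single_of_mem (⟨mulVar 0 t.1, hx⟩ : {t // t ∈ O}) (Finset.mem_univ _)
        (fun i _ hi => by simp [hi])]
      by_cases hy : mulVar 1 t.1 ∈ O
      · have hY : ∀ i, mulMatrix O s 1 i t = if i = ⟨mulVar 1 t.1, hy⟩ then 1 else 0 :=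
          fun i => by simp [mulMatrix, hy, Subtype.ext_iff]
        have h1 : borderRow O Φ 1 t = 0 := if_pos hy
        have e := sum_row fun i => C (C (mulMatrix O s 1 i t))
        rw [← e]
        simp only [hY, h1]
        rw [Finset.sum_eq_single_of_mem (⟨mulVar 1 t.1, hy⟩ : {t // t ∈ O}) (Finset.mem_univ _)
          (fun i _ hi => by simp [hi])]
        simp [borderRow, mulVar_comm 0 1]
      · have hxy : mulVar 1 (mulVar 0 t.1) ∉ O := fun h =>
          hy (hO.of_mulVar (k := 0) (by rwa [mulVar_comm]))
        have hY : ∀ i, mulMatrix O s 1 i t = s i (mulVar 1 t.1) := fun i => by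
          simp [mulMatrix, hy]
        have h1 : borderRow O Φ 1 t = Φ (mulVar 1 t.1) := if_neg hy
        have h2 : borderRow O Φ 1 ⟨mulVar 0 t.1, hx⟩ = Φ (mulVar 0 (mulVar 1 t.1)) := by
          rw [mulVar_comm]; exact if_neg hxy
        have h3 : Φ (mulVar 0 (mulVar 1 t.1)) = C X * Φ (mulVar 1 t.1) +
            ∑ p : RowEnd O, C (C (s p.1 (mulVar 1 t.1))) * φ p := by
          simp only [Φ, w_notMem _ hy, map_add, map_smul, ev_zero, smul_eq_C_mul]
        simp only [h1, h2, hY, h3]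
        simp
    · have h0 : borderRow O Φ 0 t = φ ⟨t, hx⟩ := by
        rw [← Φ_mem ⟨t, hx⟩]; exact if_neg hx
      have hX : ∀ i, mulMatrix O s 0 i t = s i (mulVar 0 t.1) := fun i => by
        simp [mulMatrix, hx]
      simp only [h0, hφ, hX, Q, map_add, map_sub, map_sum, map_smul, ev_zero, Φ_row,
        smul_eq_C_mul]
      ring
  · have : Φ (planeTerm 0 h) = G := by
      simp [Φ, w, syzygyCoord, ev_apply]
    rw [this]
    exact ⟨hG, by rw [hGdeg, Nat.card_eq_fintype_card]⟩

end Syzygy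

/-! ### Uniqueness of the solution -/

section Uniqueness

variable {A : Type*} [CommRing A]

/-- The term `t` as an element of `A[x_1][x_2]`. -/
noncomputable def termPoly (A : Type*) [CommRing A] (t : Fin 2 →₀ ℕ) : A[X][X] :=
  C (X ^ t 0) * X ^ t 1

/-- The indeterminates of `A[x_1][x_2]`. -/
noncomputable def planeVar (A : Type*) [CommRing A] : Fin 2 → A[X][X] := ![C X, X]

lemma termPoly_mulVar (r : Fin 2) (t : Fin 2 →₀ ℕ) :
    termPoly A (mulVar r t) = planeVar A r * termPoly A t := by
  fin_cases r
  · simp [termPoly, planeVar, pow_succ]; ring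
  · simp [termPoly, planeVar, pow_succ]; ring

lemma coeff_coeff_termPoly (t u : Fin 2 →₀ ℕ) :
    ((termPoly A t).coeff (u 1)).coeff (u 0) = if t = u then 1 else 0 := by
  have : t = u ↔ u 1 = t 1 ∧ u 0 = t 0 := by
    constructor
    · rintro rfl; simp
    · rintro ⟨h1, h0⟩; rw [← planeTerm_eta t, ← planeTerm_eta u, h1, h0]
  simp only [termPoly, coeff_C_mul, coeff_X_pow, this]
  by_cases h1 : u 1 = t 1 <;> simp [h1, coeff_X_pow]

/-- The polynomial `b - ∑ s_{t,b} t` attached to a term `b`, where `t` ranges over `O`. -/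
noncomputable def prebasisPoly {O : Finset (Fin 2 →₀ ℕ)} (s : {t // t ∈ O} → (Fin 2 →₀ ℕ) → A)
    (b : Fin 2 →₀ ℕ) : A[X][X] :=
  termPoly A b - ∑ i, C (C (s i b)) * termPoly A i.1

lemma coeff_coeff_prebasisPoly {O : Finset (Fin 2 →₀ ℕ)}
    (s : {t // t ∈ O} → (Fin 2 →₀ ℕ) → A) {b : Fin 2 →₀ ℕ} (hb : b ∉ O) (i : {t // t ∈ O}) :
    ((prebasisPoly s b).coeff (i.1 1)).coeff (i.1 0) = - s i b := by
  have h : b ≠ i.1 := fun e => hb (e ▸ i.2)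
  simp only [prebasisPoly, coeff_sub, finsetSum_coeff, coeff_C_mul, coeff_coeff_termPoly, if_neg h]
  rw [Finset.sum_eq_single i]
  · simp
  · intro j _ hj
    rw [if_neg fun e => hj (Subtype.ext e), mul_zero]
  · simp

lemma prebasisPoly_monic [Nontrivial A] {O : Finset (Fin 2 →₀ ℕ)}
    (s : {t // t ∈ O} → (Fin 2 →₀ ℕ) → A) {h : ℕ} (hlt : ∀ t ∈ O, t 1 < h) :
    (prebasisPoly s (planeTerm 0 h)).Monic ∧
      (prebasisPoly s (planeTerm 0 h)).natDegree = h := by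
  have h1 : termPoly A (planeTerm 0 h) = X ^ h := by simp [termPoly]
  have h2 : (∑ i, C (C (s i (planeTerm 0 h))) * termPoly A i.1).degree < (h : WithBot ℕ) := by
    refine (degree_sum_le _ _).trans_lt ((Finset.sup_lt_iff (WithBot.bot_lt_coe h)).2 ?_)
    intro i _
    rw [termPoly, ← mul_assoc, ← C_mul]
    exact (degree_C_mul_X_pow_le _ _).trans_lt (WithBot.coe_lt_coe.2 (hlt i.1 i.2))
  rw [prebasisPoly, h1]
  have hd : degree (X ^ h - ∑ i, C (C (s i (planeTerm 0 h))) * termPoly A i.1) = h := by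
    rw [degree_sub_eq_left_of_degree_lt, degree_X_pow]
    rwa [degree_X_pow]
  exact ⟨monic_X_pow_sub h2, natDegree_eq_of_degree_eq_some hd⟩

lemma vecMul_scalar_sub {ι R : Type*} [Fintype ι] [DecidableEq ι] [CommRing R] (x : R)
    (W : Matrix ι ι R) (v : ι → R) (j : ι) :
    (v ᵥ* (scalar ι x - W)) j = x * v j - ∑ i, W i j * v i := by
  have h : (v ᵥ* scalar ι x) j = v j * x := by
    simp [vecMul, dotProduct, Matrix.diagonal_apply]
  rw [vecMul_sub, Pi.sub_apply, h, mul_comm]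
  simp only [vecMul, dotProduct, mul_comm]

lemma charmatrix_map_C {ι R : Type*} [Fintype ι] [DecidableEq ι] [CommRing R]
    (M : Matrix ι ι R) :
    M.charmatrix.map (C : R[X] →+* R[X][X]) = scalar ι (C (X : R[X])) - (M.map C).map C := by
  ext i k
  by_cases h : i = k
  · subst h; simp
  · simp [charmatrix_apply, Matrix.diagonal_apply_ne _ h]

/-- The characteristic polynomials of commuting matrices, in different indeterminates, form a
regular sequence, so that the Koszul complex is exact. -/
lemma exists_eq_vecMul_charmatrix [Nontrivial A] {ι : Type*} [Fintype ι] [DecidableEq ι]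
    {M N : Matrix ι ι A} (hMN : M * N = N * M) {a b : ι → A[X][X]}
    (h : a ᵥ* (N.map C).charmatrix = b ᵥ* M.charmatrix.map C) :
    ∃ c : ι → A[X][X], a = c ᵥ* M.charmatrix.map C ∧ b = c ᵥ* (N.map C).charmatrix := by
  have hdetU : (M.charmatrix.map C).det = C M.charpoly := by
    rw [charpoly, ← RingHom.mapMatrix_apply, ← RingHom.map_det]
  refine exists_eq_vecMul_of_vecMul_eq ?_ ?_ ?_ h
  · have hc : Commute ((M.map C).map C : Matrix ι ι A[X][X]) ((N.map C).map C) := by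
      rw [Commute, SemiconjBy, ← Matrix.map_mul, ← Matrix.map_mul, ← Matrix.map_mul,
        ← Matrix.map_mul, hMN]
    have hs : ∀ (r : A[X][X]) (W : Matrix ι ι A[X][X]), Commute (scalar ι r) W :=
      fun r W => scalar_commute r (fun _ => Commute.all _ _) W
    rw [charmatrix_map_C]
    exact ((hs _ _).sub_right (hs _ _)).sub_left (((hs _ _).symm).sub_right hc)
  · rw [hdetU]
    have : IsLeftRegular M.charpoly := M.charpoly_monic.isRegular.left
    intro p q hpq
    ext1 k
    refine this ?_
    simpa using congrArg (fun z => z.coeff k) hpq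
  · intro p hp
    rw [hdetU] at hp ⊢
    let π := Ideal.Quotient.mk (Ideal.span {M.charpoly})
    have key : ∀ q : A[X][X], C M.charpoly ∣ q ↔ q.map π = 0 := fun q => by
      rw [C_dvd_iff_dvd_coeff, Polynomial.ext_iff]
      simp [π, Ideal.Quotient.eq_zero_iff_mem, Ideal.mem_span_singleton]
    rw [key] at hp ⊢
    rw [Polynomial.map_mul] at hp
    have hm : ((N.map C).charmatrix.det.map π).Monic := (charpoly_monic (N.map C)).map π
    exact hm.mul_right_eq_zero_iff.1 hp

/-- By the exactness of the Koszul complex, a solution of the syzygies comes from a row vector. -/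
lemma IsSyzygy.exists_borderRow_eq [Nontrivial A] {O : Finset (Fin 2 →₀ ℕ)}
    {s : {t // t ∈ O} → (Fin 2 →₀ ℕ) → A}
    (hcomm : mulMatrix O s 0 * mulMatrix O s 1 = mulMatrix O s 1 * mulMatrix O s 0)
    {Φ : (Fin 2 →₀ ℕ) → A[X][X]} (hΦ : IsSyzygy O s Φ) :
    ∃ c : {t // t ∈ O} → A[X][X], ∀ q j, borderRow O Φ q j =
      planeVar A q * c j - ∑ i, C (C (mulMatrix O s q i j)) * c i := by
  obtain ⟨c, hc0, hc1⟩ := exists_eq_vecMul_charmatrix hcomm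
    (a := borderRow O Φ 0) (b := borderRow O Φ 1) (by
      funext j
      rw [charmatrix_map_C, vecMul_scalar_sub, charmatrix, vecMul_scalar_sub]
      exact hΦ j)
  refine ⟨c, fun q j => ?_⟩
  fin_cases q
  · have h := congrFun hc0 j
    rw [charmatrix_map_C, vecMul_scalar_sub] at h
    exact h
  · have h := congrFun hc1 j
    rw [charmatrix, vecMul_scalar_sub] at h
    exact h

/-- Every solution of the syzygies is proportional to the family of the polynomials
`b - ∑ s_{t,b} t`. -/
theorem IsSyzygy.exists_eq_prebasisPoly_mul [Nontrivial A] {O : Finset (Fin 2 →₀ ℕ)}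
    (hO : IsOrderIdeal O) {s : {t // t ∈ O} → (Fin 2 →₀ ℕ) → A}
    (hcomm : mulMatrix O s 0 * mulMatrix O s 1 = mulMatrix O s 1 * mulMatrix O s 0)
    {Φ : (Fin 2 →₀ ℕ) → A[X][X]} (hΦ : IsSyzygy O s Φ) (h00 : 0 ∈ O) :
    ∃ g : A[X][X], ∀ (r : Fin 2) (t : {t // t ∈ O}), mulVar r t.1 ∉ O →
      Φ (mulVar r t.1) = prebasisPoly s (mulVar r t.1) * g := by
  obtain ⟨c, e⟩ := hΦ.exists_borderRow_eq hcomm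
  -- Along `O` the vector `c` is multiplied by the indeterminates.
  have step : ∀ (q : Fin 2) (t : Fin 2 →₀ ℕ) (ht : t ∈ O) (hq : mulVar q t ∈ O),
      c ⟨mulVar q t, hq⟩ = planeVar A q * c ⟨t, ht⟩ := fun q t ht hq => by
    have h := e q ⟨t, ht⟩
    rw [borderRow, if_pos hq,
      Finset.sum_eq_single_of_mem (⟨mulVar q t, hq⟩ : {t // t ∈ O}) (Finset.mem_univ _)] at h
    · rw [eq_comm, sub_eq_zero] at h
      simpa [mulMatrix, hq] using h.symm
    · intro i _ hi
      have : i.1 ≠ mulVar q t := fun e => hi (Subtype.ext e)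
      simp [mulMatrix, hq, this]
  obtain ⟨g, hg⟩ : ∃ g, ∀ i : {t // t ∈ O}, c i = termPoly A i.1 * g := by
    refine ⟨c ⟨0, h00⟩, fun i => ?_⟩
    have aux : ∀ a b t, t = planeTerm a b → ∀ ht : t ∈ O,
        c ⟨t, ht⟩ = termPoly A t * c ⟨0, h00⟩ := by
      intro a b
      induction a with
      | zero =>
        induction b with
        | zero =>
          rintro t rfl ht
          have z : planeTerm 0 0 = 0 := by simp [planeTerm]
          simp [z, termPoly]
        | succ b ih =>
          intro t e ht
          obtain rfl : t = mulVar 1 (planeTerm 0 b) := by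
            rw [e, ← planeTerm_eta (mulVar 1 _)]; simp
          rw [step 1 _ (hO.of_mulVar ht) ht, ih _ rfl, termPoly_mulVar, mul_assoc]
      | succ a ih =>
        intro t e ht
        obtain rfl : t = mulVar 0 (planeTerm a b) := by
          rw [e, ← planeTerm_eta (mulVar 0 _)]; simp
        rw [step 0 _ (hO.of_mulVar ht) ht, ih _ rfl, termPoly_mulVar, mul_assoc]
    exact aux _ _ _ (planeTerm_eta i.1).symm i.2
  refine ⟨g, fun q j hj => ?_⟩
  have h := e q j
  have hm : ∀ i, mulMatrix O s q i j = s i (mulVar q j.1) := fun i => by simp [mulMatrix, hj]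
  rw [borderRow, if_neg hj] at h
  simp only [hm, hg] at h
  simp only [h, prebasisPoly, sub_mul, Finset.sum_mul, termPoly_mulVar, mul_assoc]

/-- A solution of the syzygies that is monic at the border term `x_2^h` and whose degree in `x_2`
there is at most `h` consists of the polynomials `b - ∑ s_{t,b} t`. -/
theorem IsSyzygy.eq_prebasisPoly [Nontrivial A] {O : Finset (Fin 2 →₀ ℕ)} (hO : IsOrderIdeal O)
    {s : {t // t ∈ O} → (Fin 2 →₀ ℕ) → A}
    (hcomm : mulMatrix O s 0 * mulMatrix O s 1 = mulMatrix O s 1 * mulMatrix O s 0)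
    {Φ : (Fin 2 →₀ ℕ) → A[X][X]} (hΦ : IsSyzygy O s Φ) {k : ℕ} (hk : planeTerm 0 k ∈ O)
    (hk' : planeTerm 0 (k + 1) ∉ O) (hmonic : (Φ (planeTerm 0 (k + 1))).Monic)
    (hdeg : (Φ (planeTerm 0 (k + 1))).natDegree ≤ k + 1) {r : Fin 2} {t : {t // t ∈ O}}
    (ht : mulVar r t.1 ∉ O) : Φ (mulVar r t.1) = prebasisPoly s (mulVar r t.1) := by
  obtain ⟨g, main⟩ := hΦ.exists_eq_prebasisPoly_mul hO hcomm (hO _ hk _ fun i => Nat.zero_le _)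
  -- Comparing degrees at `x_2^h` shows that the constant of proportionality is `1`.
  have hone : g = 1 := by
    have hlt : ∀ t ∈ O, t 1 < k + 1 := fun t ht => by
      by_contra! hle
      refine hk' (hO t ht _ fun i => ?_)
      fin_cases i <;> simp [hle]
    obtain ⟨gm, gd⟩ := prebasisPoly_monic s hlt
    have hb : mulVar 1 (planeTerm 0 k) = planeTerm 0 (k + 1) := by
      rw [← planeTerm_eta (mulVar 1 _)]; simp
    have h := main 1 ⟨_, hk⟩ (by simpa only [hb] using hk')
    simp only [hb] at h
    rw [h] at hmonic hdeg
    have cm := gm.of_mul_monic_left hmonic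
    rw [gm.natDegree_mul cm, gd] at hdeg
    exact cm.natDegree_eq_zero.1 (by omega)
  rw [main r t ht, hone, mul_one]

end Uniqueness
end BorderBasis

namespace BorderBasis

/-! ### Generation by the exposed indeterminates -/

section Generation

open Polynomial in
/-- Only exposed entries of the multiplication matrices contribute to the syzygies, so that a
solution for `s'` is mapped to a solution for `s` as soon as the exposed coordinates agree. -/
lemma IsSyzygy.map {A B : Type*} [CommRing A] [CommRing B] (f : A →+* B)
    {O : Finset (Fin 2 →₀ ℕ)} {s' : {t // t ∈ O} → (Fin 2 →₀ ℕ) → A}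
    {s : {t // t ∈ O} → (Fin 2 →₀ ℕ) → B}
    (hs : ∀ q l : Fin 2, q ≠ l → ∀ i j : {t // t ∈ O}, mulVar l i.1 ∉ O → mulVar q j.1 ∉ O →
      f (s' i (mulVar q j.1)) = s i (mulVar q j.1))
    {Φ : (Fin 2 →₀ ℕ) → A[X][X]} (hΦ : IsSyzygy O s' Φ) :
    IsSyzygy O s fun b => (Φ b).map (mapRingHom f) := by
  have hrow : ∀ r i, borderRow O (fun b => (Φ b).map (mapRingHom f)) r i =
      (borderRow O Φ r i).map (mapRingHom f) := fun r i => by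
    unfold borderRow; split_ifs <;> simp
  have hterm : ∀ q l : Fin 2, q ≠ l → ∀ i j : {t // t ∈ O},
      C (C (f (mulMatrix O s' q i j))) * (borderRow O Φ l i).map (mapRingHom f) =
        C (C (mulMatrix O s q i j)) * (borderRow O Φ l i).map (mapRingHom f) := by
    intro q l hql i j
    by_cases hl : mulVar l i.1 ∈ O
    · simp [borderRow, hl]
    · have h : f (mulMatrix O s' q i j) = mulMatrix O s q i j := by
        by_cases hq : mulVar q j.1 ∈ O
        · simp only [mulMatrix, Matrix.of_apply, if_pos hq]
          split_ifs <;> simp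
        · simp only [mulMatrix, Matrix.of_apply, if_neg hq]
          exact hs q l hql i j hl hq
      rw [h]
  intro j
  have h := congrArg (Polynomial.map (mapRingHom f)) (hΦ j)
  simp only [Polynomial.map_sub, Polynomial.map_mul, Polynomial.map_sum, map_X, map_C,
    coe_mapRingHom] at h
  simp only [hterm 1 0 (by decide), hterm 0 1 (by decide)] at h
  simpa only [hrow] using h

lemma mulVar_ne_mulVar {n : ℕ} {q l : Fin n} (h : q ≠ l) (t : Fin n →₀ ℕ) :
    mulVar q t ≠ mulVar l t := fun e => by
  have := DFunLike.congr_fun e q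
  simp [mulVar, h.symm] at this

/-- The indeterminates in the columns of the border terms `x_q t` with `t ∈ O` are exposed in the
rows of the terms `u` for which `x_l u` is a border term, where `l ≠ q`. -/
lemma isExposed_mulVar {n : ℕ} {O : Finset (Fin n →₀ ℕ)} (hO : IsOrderIdeal O) {q l : Fin n}
    (hql : q ≠ l) {u t : {t // t ∈ O}} (hl : mulVar l u.1 ∉ O) (hq : mulVar q t.1 ∉ O) :
    IsExposed O (u, ⟨mulVar q t.1, mulVar_mem_border t.2 hq⟩) := by
  refine ⟨l, mulVar_mem_border u.2 hl, ?_⟩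
  by_cases ht : mulVar l t.1 ∈ O
  · refine ⟨mulVar l (mulVar q t.1), ?_, Or.inl rfl⟩
    rw [mulVar_comm]
    refine mulVar_mem_border ht fun h => hq ?_
    rw [mulVar_comm] at h
    exact hO.of_mulVar h
  · exact ⟨mulVar l t.1, mulVar_mem_border t.2 ht,
      Or.inr ⟨⟨mulVar_ne_mulVar hql t.1, q, l, t.1, t.2, rfl, rfl⟩, q, mulVar_comm q l t.1⟩⟩

variable (K : Type*) [Field K] (O : Finset (Fin 2 →₀ ℕ))

/-- The class of `c_{tb}` in the coordinate ring, with the value `0` if `b` is not a border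
term. -/
noncomputable def borderCoord (t : {t // t ∈ O}) (b : Fin 2 →₀ ℕ) : CoordRing K O :=
  if h : b ∈ border O then Ideal.Quotient.mk (schemeIdeal K O) (MvPolynomial.X (t, ⟨b, h⟩)) else 0

lemma multMatrix_map_mk (r : Fin 2) :
    (multMatrix K O r).map (Ideal.Quotient.mk (schemeIdeal K O)) =
      mulMatrix O (borderCoord K O) r := by
  ext i j
  by_cases h : mulVar r j.1 ∈ O
  · simp only [multMatrix, mulMatrix, Matrix.map_apply, Matrix.of_apply, dif_pos h, if_pos h,
      Subtype.ext_iff]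
    split_ifs <;> simp
  · simp [multMatrix, mulMatrix, h, borderCoord, mulVar_mem_border j.2 h]

lemma mulMatrix_borderCoord_comm :
    mulMatrix O (borderCoord K O) 0 * mulMatrix O (borderCoord K O) 1 =
      mulMatrix O (borderCoord K O) 1 * mulMatrix O (borderCoord K O) 0 := by
  rw [← multMatrix_map_mk, ← multMatrix_map_mk, ← Matrix.map_mul, ← Matrix.map_mul]
  ext i j
  have : (multMatrix K O 0 * multMatrix K O 1 - multMatrix K O 1 * multMatrix K O 0) i j ∈
      schemeIdeal K O := Ideal.subset_span ⟨0, 1, by decide, i, j, rfl⟩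
  exact Ideal.Quotient.eq.2 this

variable {O}

/-- The exposed indeterminates generate the coordinate ring of the planar border basis scheme. -/
theorem adjoin_exposed_eq_top (hO : IsOrderIdeal O) :
    Algebra.adjoin K {a : CoordRing K O | ∃ c : Indet O, IsExposed O c ∧
      a = Ideal.Quotient.mk (schemeIdeal K O) (MvPolynomial.X c)} = ⊤ := by
  classical
  set S := Algebra.adjoin K {a : CoordRing K O | ∃ c : Indet O, IsExposed O c ∧
      a = Ideal.Quotient.mk (schemeIdeal K O) (MvPolynomial.X c)} with hS
  rcases subsingleton_or_nontrivial (CoordRing K O) with hB | hB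
  · exact eq_top_iff.2 fun a _ => Subsingleton.elim 0 a ▸ S.zero_mem
  have key : ∀ c : Indet O, Ideal.Quotient.mk (schemeIdeal K O) (MvPolynomial.X c) ∈ S := by
    rintro ⟨u, b, hb⟩
    obtain ⟨⟨r, t, ht, rfl⟩, hbO⟩ := mem_border_iff.1 hb
    -- The border contains a power of `x_2`, namely `x_2^(k + 1)` for the `k` found here.
    have hex : ∃ k, planeTerm 0 k ∉ O := by
      by_contra! h
      refine Set.infinite_of_injective_forall_mem (f := planeTerm 0) ?_ h O.finite_toSet
      intro a b e
      simpa using DFunLike.congr_fun e 1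
    obtain ⟨k, hk⟩ : ∃ k, Nat.find hex = k + 1 := by
      refine Nat.exists_eq_succ_of_ne_zero fun h => ?_
      have := Nat.find_spec hex
      rw [h] at this
      exact this (hO t ht _ fun i => by fin_cases i <;> simp)
    have hk1 : planeTerm 0 (k + 1) ∉ O := hk ▸ Nat.find_spec hex
    have hk0 : planeTerm 0 k ∈ O := by
      by_contra h
      have := Nat.find_min' hex h
      omega
    let s' : {t // t ∈ O} → (Fin 2 →₀ ℕ) → S := fun i b =>
      if h : borderCoord K O i b ∈ S then ⟨_, h⟩ else 0
    obtain ⟨Φ, hΦ, hmon⟩ := exists_isSyzygy hO s'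
    have hs : ∀ q l : Fin 2, q ≠ l → ∀ i j : {t // t ∈ O}, mulVar l i.1 ∉ O → mulVar q j.1 ∉ O →
        (S.val : S →+* CoordRing K O) (s' i (mulVar q j.1)) = borderCoord K O i (mulVar q j.1) := by
      intro q l hql i j hl hq
      have hmem : borderCoord K O i (mulVar q j.1) ∈ S := by
        rw [borderCoord, dif_pos (mulVar_mem_border j.2 hq)]
        exact Algebra.subset_adjoin ⟨_, isExposed_mulVar hO hql hl hq, rfl⟩
      simp [s', hmem]
    obtain ⟨hm, hd⟩ := hmon (k + 1)
    have h := (hΦ.map _ hs).eq_prebasisPoly hO (mulMatrix_borderCoord_comm K O) hk0 hk1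
      (hm.map _) ((Polynomial.natDegree_map_le).trans (hd.trans_le (card_rowEnd_le hO hk1)))
      (r := r) (t := ⟨t, ht⟩) hbO
    have h2 := congrArg (fun p => (p.coeff (u.1 1)).coeff (u.1 0)) h
    simp only [coeff_coeff_prebasisPoly _ hbO u, Polynomial.coeff_map,
      Polynomial.coe_mapRingHom] at h2
    rw [borderCoord, dif_pos hb, eq_comm, neg_eq_iff_eq_neg] at h2
    rw [h2]
    exact S.neg_mem (SetLike.coe_mem _)
  refine eq_top_iff.2 fun a _ => ?_
  obtain ⟨p, rfl⟩ := Ideal.Quotient.mk_surjective a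
  induction p using MvPolynomial.induction_on with
  | C a => exact S.algebraMap_mem a
  | add p q hp hq => rw [map_add]; exact S.add_mem (hp trivial) (hq trivial)
  | mul_X p c hp => rw [map_mul]; exact S.mul_mem (hp trivial) (key c)

end Generation

/-! ### Linear parts and basic indeterminates -/

section LinearPart

open MvPolynomial

variable {K σ : Type*} [Field K]

/-- The coefficient of the indeterminate `c` in the linear part of a polynomial. -/
noncomputable def linearCoeff (c : σ) : MvPolynomial σ K →ₗ[K] K :=
  lcoeff K (Finsupp.single c 1)

lemma linearCoeff_eq_constantCoeff_pderiv (c : σ) (p : MvPolynomial σ K) :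
    linearCoeff c p = constantCoeff (pderiv c p) := by
  classical
  simp [linearCoeff, constantCoeff_eq, coeff_pderiv]

lemma linearCoeff_mul (c : σ) (p q : MvPolynomial σ K) :
    linearCoeff c (p * q) =
      constantCoeff p * linearCoeff c q + constantCoeff q * linearCoeff c p := by
  simp [linearCoeff_eq_constantCoeff_pderiv, Derivation.leibniz]

lemma mem_vars_homogeneousComponent_one {c : σ} {p : MvPolynomial σ K}
    (h : linearCoeff c p ≠ 0) : c ∈ (homogeneousComponent 1 p).vars := by
  classical
  rw [mem_vars_iff_mem_support]
  refine ⟨Finsupp.single c 1, ?_, by simp⟩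
  rw [mem_support_iff, coeff_homogeneousComponent]
  simpa [linearCoeff] using h

/-- An ideal generated by polynomials without constant term and without the linear term in `c`
contains only such polynomials. -/
lemma linearCoeff_eq_zero_of_mem_span {G : Set (MvPolynomial σ K)} {c : σ}
    (h0 : ∀ g ∈ G, constantCoeff g = 0) (h1 : ∀ g ∈ G, linearCoeff c g = 0)
    {p : MvPolynomial σ K} (hp : p ∈ Ideal.span G) : linearCoeff c p = 0 := by
  suffices constantCoeff p = 0 ∧ linearCoeff c p = 0 from this.2
  induction hp using Submodule.span_induction with
  | mem g hg => exact ⟨h0 g hg, h1 g hg⟩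
  | zero => simp
  | add p q _ _ hp hq => simp [hp, hq]
  | smul q p _ hp => simp [linearCoeff_mul, hp]

variable {n : ℕ} {O : Finset (Fin n →₀ ℕ)}

lemma constantCoeff_multMatrix (r : Fin n) (i j : {t // t ∈ O}) :
    constantCoeff (multMatrix K O r i j) = if i.1 = mulVar r j.1 then 1 else 0 := by
  by_cases h : mulVar r j.1 ∈ O
  · simp only [multMatrix, Matrix.of_apply, dif_pos h, Subtype.ext_iff]
    split_ifs <;> simp
  · have : i.1 ≠ mulVar r j.1 := fun e => h (e ▸ i.2)
    simp [multMatrix, h, this]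

lemma linearCoeff_multMatrix (c : Indet O) (r : Fin n) (i j : {t // t ∈ O}) :
    linearCoeff c (multMatrix K O r i j) =
      if c.1 = i ∧ c.2.1 = mulVar r j.1 then 1 else 0 := by
  classical
  by_cases h : mulVar r j.1 ∈ O
  · have : c.2.1 ≠ mulVar r j.1 := fun e => (mem_border_iff.1 c.2.2).2 (e ▸ h)
    simp only [multMatrix, Matrix.of_apply, dif_pos h, linearCoeff_eq_constantCoeff_pderiv]
    split_ifs <;> simp_all
  · have e : (i, (⟨mulVar r j.1, mulVar_mem_border j.2 h⟩ : {b // b ∈ border O})) = c ↔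
        c.1 = i ∧ c.2.1 = mulVar r j.1 := by
      rw [eq_comm, Prod.ext_iff, Subtype.ext_iff (a1 := c.2)]
    simp only [multMatrix, Matrix.of_apply, dif_neg h, linearCoeff_eq_constantCoeff_pderiv,
      pderiv_X, Pi.single_apply, ← e]
    split_ifs <;> simp

lemma constantCoeff_multMatrix_mul (hO : IsOrderIdeal O) (r s : Fin n) (i j : {t // t ∈ O}) :
    constantCoeff ((multMatrix K O r * multMatrix K O s) i j) =
      if i.1 = mulVar r (mulVar s j.1) then 1 else 0 := by
  simp only [Matrix.mul_apply, map_sum, map_mul, constantCoeff_multMatrix]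
  split_ifs with h
  · have hs : mulVar s j.1 ∈ O := hO.of_mulVar (h ▸ i.2)
    rw [Finset.sum_eq_single_of_mem (⟨_, hs⟩ : {t // t ∈ O}) (Finset.mem_univ _)]
    · simp [h]
    · intro k _ hk
      have hk' : k.1 ≠ mulVar s j.1 := fun e => hk (Subtype.ext e)
      simp [hk']
  · refine Finset.sum_eq_zero fun k _ => ?_
    by_cases hk : k.1 = mulVar s j.1
    · simp [hk, h]
    · simp [hk]

/-- If `i ≠ c.1`, the linear part of the entry at `(i, j)` of a product of multiplication matrices
contains `c` only through the product of a shift by `x_r` and a border column. -/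
lemma linearCoeff_multMatrix_mul {c : Indet O} (r s : Fin n) {i j : {t // t ∈ O}}
    (hi : c.1 ≠ i) :
    linearCoeff c ((multMatrix K O r * multMatrix K O s) i j) =
      if i.1 = mulVar r c.1.1 ∧ c.2.1 = mulVar s j.1 then 1 else 0 := by
  simp only [Matrix.mul_apply, map_sum, linearCoeff_mul, constantCoeff_multMatrix,
    linearCoeff_multMatrix]
  rw [Finset.sum_eq_single_of_mem c.1 (Finset.mem_univ _)]
  · by_cases h1 : i.1 = mulVar r c.1.1 <;> by_cases h2 : c.2.1 = mulVar s j.1 <;> simp [hi, h1, h2]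
  · intro k _ hk
    simp [hi, hk.symm]

lemma constantCoeff_generator (hO : IsOrderIdeal O) {g : MvPolynomial (Indet O) K}
    (hg : g ∈ generators K O) : constantCoeff g = 0 := by
  obtain ⟨r, s, -, i, j, rfl⟩ := hg
  rw [Matrix.sub_apply, map_sub, constantCoeff_multMatrix_mul hO, constantCoeff_multMatrix_mul hO,
    mulVar_comm, sub_self]

/-- A basic indeterminate `c_{ub}` with `b = x_q t` is exposed: if `x_l u` were in `O` for the other
index `l`, then `c_{ub}` would occur in the linear part of the generator at `(x_l u, t)`. -/
lemma IsBasic.isExposed {O : Finset (Fin 2 →₀ ℕ)} (hO : IsOrderIdeal O) {c : Indet O}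
    (hc : IsBasic K O c) : IsExposed O c := by
  obtain ⟨u, b, hb⟩ := c
  obtain ⟨⟨q, t, ht, rfl⟩, hbO⟩ := mem_border_iff.1 hb
  obtain ⟨l, hql⟩ : ∃ l, q ≠ l := by fin_cases q <;> simp
  refine isExposed_mulVar hO hql (t := ⟨t, ht⟩) (fun hl => ?_) hbO
  have hi : u ≠ ⟨mulVar l u.1, hl⟩ := fun e => by
    have := DFunLike.congr_fun (congrArg Subtype.val e) l
    simp [mulVar] at this
  have h1 : linearCoeff (u, ⟨mulVar q t, hb⟩)
      ((multMatrix K O l * multMatrix K O q) ⟨mulVar l u.1, hl⟩ ⟨t, ht⟩) = 1 := by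
    rw [linearCoeff_multMatrix_mul _ _ hi]; simp
  have h2 : linearCoeff (u, ⟨mulVar q t, hb⟩)
      ((multMatrix K O q * multMatrix K O l) ⟨mulVar l u.1, hl⟩ ⟨t, ht⟩) = 0 := by
    rw [linearCoeff_multMatrix_mul _ _ hi]; simp [mulVar_ne_mulVar hql.symm]
  rcases lt_or_gt_of_ne hql with h | h
  · refine hc _ ⟨q, l, h, ⟨mulVar l u.1, hl⟩, ⟨t, ht⟩, rfl⟩ (mem_vars_homogeneousComponent_one ?_)
    rw [Matrix.sub_apply, map_sub, h1, h2]; simp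
  · refine hc _ ⟨l, q, h, ⟨mulVar l u.1, hl⟩, ⟨t, ht⟩, rfl⟩ (mem_vars_homogeneousComponent_one ?_)
    rw [Matrix.sub_apply, map_sub, h1, h2]; simp

/-- A basic indeterminate cannot be eliminated: `z_i - h_i` has the coefficient `1` at `z_i`, but no
polynomial in the ideal has a linear term in a basic indeterminate. -/
lemma IsBasic.notMem_range (hO : IsOrderIdeal O) {c : Indet O} (hc : IsBasic K O c) {s : ℕ}
    {Z : Fin s → Indet O} (hZ : HasSeparatingReembedding (schemeIdeal K O) Z) :
    c ∉ Set.range Z := by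
  classical
  rintro ⟨i, rfl⟩
  obtain ⟨-, h, hI, -⟩ := hZ
  have h0 := linearCoeff_eq_zero_of_mem_span (fun g hg => constantCoeff_generator hO hg)
    (fun g hg => not_not.1 fun hne => hc g hg (mem_vars_homogeneousComponent_one hne)) (hI i)
  have hv : Z i ∉ (inclCompl Z (h i)).vars := fun hm => by
    obtain ⟨d, -, hd⟩ := mem_vars_rename _ _ hm
    exact d.2 ⟨i, hd.symm⟩
  rw [map_sub, linearCoeff_eq_constantCoeff_pderiv, linearCoeff_eq_constantCoeff_pderiv,
    pderiv_eq_zero_of_notMem_vars hv] at h0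
  simp at h0

end LinearPart

end BorderBasis

theorem mainTheorem2 {K : Type*} [Field K] (O : Finset (Fin 2 →₀ ℕ))
    (hO : BorderBasis.IsOrderIdeal O) :
    Algebra.adjoin K {a : BorderBasis.CoordRing K O | ∃ c : BorderBasis.Indet O,
        BorderBasis.IsExposed O c ∧
          a = Ideal.Quotient.mk (BorderBasis.schemeIdeal K O) (MvPolynomial.X c)} = ⊤ ∧
    ∀ c : BorderBasis.Indet O, BorderBasis.IsBasic K O c →
      BorderBasis.IsExposed O c ∧
        ∀ (s : ℕ) (Z : Fin s → BorderBasis.Indet O),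
          BorderBasis.HasSeparatingReembedding (BorderBasis.schemeIdeal K O) Z →
            c ∉ Set.range Z :=
  ⟨BorderBasis.adjoin_exposed_eq_top K hO, fun _ hc =>
    ⟨hc.isExposed hO, fun _ _ hZ => hc.notMem_range hO hZ⟩⟩
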